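/- Work over the max-plus semiring $\mathbb{R}_{\max}=\mathbb{R}\cup\{-\infty\}$ and write $[n]=\{1,\dots,n\}$. Let $\mathcal{C}\subset\mathbb{R}_{\max}^n$ be the real polyhedral cone generated by $v^1,\dots,v^p\in\mathbb{R}^n$, i.e. the set of all vectors $x$ with $x_i=\max_{r\in[p]}(\lambda_r+v^r_i)$ for $i\in[n]$, where $\lambda_1,\dots,\lambda_p\in\mathbb{R}_{\max}$. For $a\in\mathbb{R}^n$ and a non-empty proper subset $I$ of $[n]$, the tropical half-space with apex $a$ and set of sectors $I$ is $$\mathcal{H}(a,I)=\{x\in\mathbb{R}_{\max}^n : \max_{i\in I}(x_i-a_i)\ \ge\ \max_{i\in[n]\setminus I}(x_i-a_i)\};$$ apices are considered up to adding a constant to all coordinates. A non-redundant external representation of $\mathcal{C}$ is a finite set $\Gamma$ of half-spaces containing $\mathcal{C}$ and with apices in $\mathcal{C}$, such that $\mathcal{C}=\bigcap_{\mathcal{H}\in\Gamma}\mathcal{H}$ and $\bigcap_{\mathcal{H}'\in\Gamma\setminus\{\mathcal{H}\}}\mathcal{H}'\not\subset\mathcal{H}$ for each $\mathcal{H}\in\Gamma$.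 A vector $a$ is a non-redundant apex of $\mathcal{C}$ if non-redundant external representations of $\mathcal{C}$ exist and $a$ is the apex of some half-space in each of them. For $a\in\mathbb{R}^n$ and $j\in[n]$ let $S_j(a)=\{r\in[p] : v^r_j-a_j\ge v^r_i-a_i \text{ for all } i\in[n]\}$. For a non-empty proper subset $I$ of $[n]$ and $j\in[n]\setminus I$, the vector $a$ is an $(I,j)$-vertex of $\mathcal{C}$ if - (C1) $\bigcup_{i\in I}S_i(a)=[p]$; - (C2) for each $h\in[n]\setminus I$ there exists $i\in I$ such that $S_i(a)\cap S_h(a)\neq\emptyset$; - (C4) $S_i(a)\cap S_j(a)\not\subset\bigcup_{k\in I\setminus\{i\}}S_k(a)$ for all $i\in I$. **Theorem.** If $a$ is an $(I,j)$-vertex of $\mathcal{C}$ that also satisfies - (C5) $S_i(a)\cap S_j(a)\not\subset\bigcup_{k\in[n]\setminus\{i,j\}}S_k(a)$ for all $i\in I$, then $a$ is a non-redundant apex of $\mathcal{C}$. -/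

import Mathlib

/-!
Max-plus vectors are functions `Fin n → WithBot ℝ`, where `⊥` is `-∞`, tropical addition is the
maximum and tropical multiplication is `+`.  A tropical cone and a tropical half-space are sets of
such vectors that are stable under tropical scalar multiplication, so points of the projective
spaces are handled through representatives.
-/

namespace TropicalCone

/-- A real vector, seen as a max-plus vector. -/
def toMaxPlus {n : ℕ} (a : Fin n → ℝ) : Fin n → WithBot ℝ := fun i => (a i : WithBot ℝ)

/-- The real polyhedral cone generated by the real vectors `v 0, …, v (p - 1)`: all vectors
`i ↦ max_r (lam r + v r i)`, with coefficients `lam r` in `ℝ ∪ {-∞}`. -/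
def cone {n p : ℕ} (v : Fin p → Fin n → ℝ) : Set (Fin n → WithBot ℝ) :=
  {x | ∃ lam : Fin p → WithBot ℝ, ∀ i, x i = Finset.univ.sup fun r => lam r + (v r i : WithBot ℝ)}

/-- The partial max-plus linear form `x ↦ max_{i ∈ I} (x i - a i)`, equal to `-∞` if `I = ∅`. -/
noncomputable def form {n : ℕ} (a : Fin n → ℝ) (I : Finset (Fin n)) (x : Fin n → WithBot ℝ) :
    WithBot ℝ :=
  I.sup fun i => x i + ((-a i : ℝ) : WithBot ℝ)

/-- The set `H(a, I)` of all `x` with `max_{i ∈ I} (x i - a i) ≥ max_{i ∉ I} (x i - a i)`. -/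
def halfSpace {n : ℕ} (a : Fin n → ℝ) (I : Finset (Fin n)) : Set (Fin n → WithBot ℝ) :=
  {x | form a Iᶜ x ≤ form a I x}

/-- `H` is a (non-degenerate) tropical half-space with apex `a`: it is `H(a, I)` for some
non-empty proper subset `I`.  The vector `a` is determined by `H` up to an additive constant. -/
def HasApex {n : ℕ} (H : Set (Fin n → WithBot ℝ)) (a : Fin n → ℝ) : Prop :=
  ∃ I : Finset (Fin n), I.Nonempty ∧ I ≠ Finset.univ ∧ H = halfSpace a I

/-- The set of the half-spaces that contain `C` and whose apex belongs to `C`. -/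
def supportingHalfSpaces {n : ℕ} (C : Set (Fin n → WithBot ℝ)) : Set (Set (Fin n → WithBot ℝ)) :=
  {H | C ⊆ H ∧ ∃ a : Fin n → ℝ, toMaxPlus a ∈ C ∧ HasApex H a}

/-- A non-redundant external representation of `C`: a finite set of half-spaces that contain `C`
and have their apices in `C`, whose intersection is `C`, and none of which contains the
intersection of the others. -/
def IsNonRedundantRepresentation {n : ℕ} (C : Set (Fin n → WithBot ℝ))
    (Γ : Set (Set (Fin n → WithBot ℝ))) : Prop :=
  Γ.Finite ∧ Γ ⊆ supportingHalfSpaces C ∧ ⋂₀ Γ = C ∧ ∀ H ∈ Γ, ¬ ⋂₀ (Γ \ {H}) ⊆ H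

/-- `a` is a non-redundant apex of `C`: non-redundant external representations of `C` exist, and
`a` is the apex of a half-space of each of them. -/
def IsNonRedundantApex {n : ℕ} (C : Set (Fin n → WithBot ℝ)) (a : Fin n → ℝ) : Prop :=
  (∃ Γ, IsNonRedundantRepresentation C Γ) ∧
    ∀ Γ, IsNonRedundantRepresentation C Γ → ∃ H ∈ Γ, HasApex H a

/-- The entry `S_j(x)` of the type of `x` relative to the vectors `v r`. -/
def typeSet {n p : ℕ} (v : Fin p → Fin n → ℝ) (x : Fin n → ℝ) (j : Fin n) : Set (Fin p) :=
  {r | ∀ i, v r i - x i ≤ v r j - x j}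

/-- `a` is an `(I, j)`-vertex of the cone generated by the vectors `v r`. -/
structure IsVertex {n p : ℕ} (v : Fin p → Fin n → ℝ) (a : Fin n → ℝ) (I : Finset (Fin n))
    (j : Fin n) : Prop where
  nonempty : I.Nonempty
  notMem : j ∉ I
  c1 : ⋃ i ∈ I, typeSet v a i = Set.univ
  c2 : ∀ h ∉ I, ∃ i ∈ I, (typeSet v a i ∩ typeSet v a h).Nonempty
  c4 : ∀ i ∈ I, ¬ typeSet v a i ∩ typeSet v a j ⊆ ⋃ k ∈ I \ {i}, typeSet v a k

/-- Condition (C5): `S_i(a) ∩ S_j(a) ⊄ ⋃_{k ∉ {i, j}} S_k(a)` for all `i ∈ I`. -/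
def ConditionC5 {n p : ℕ} (v : Fin p → Fin n → ℝ) (a : Fin n → ℝ) (I : Finset (Fin n))
    (j : Fin n) : Prop :=
  ∀ i ∈ I, ¬ typeSet v a i ∩ typeSet v a j ⊆ ⋃ k ∈ ({i, j} : Finset (Fin n))ᶜ, typeSet v a k

end TropicalCone

open Filter Topology

namespace TropicalCone

variable {n p : ℕ}

/-! Raising coordinate `j ∉ I` of `a` by any `ε > 0` leaves `H(a, I)`, hence the cone. In a finite
representation, some `H(b, K)` therefore excludes `a + ε e_j` for arbitrarily small `ε`. Since `a`
lies in `H(b, K)`, letting `ε → 0` shows that `a - b` is maximal at `j`. The generators given by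
(C5) force equality on `I`, and `b ∈ C ⊆ H(a, I)` forces it elsewhere, so `b` is `a` up to a
constant (`hasApex_of_frequently_notMem`).

Representations exist because every point outside the cone is cut off by a half-space taken from a
finite list (`exists_separating_data`), whose apex can be projected into the cone
(`exists_halfSpace_coneProj`); a minimal subfamily is non-redundant. -/

/-! ### Membership in half-spaces -/

theorem withBot_add_neg_le_add_neg_iff (x y : WithBot ℝ) (s t : ℝ) :
    x + ((-s : ℝ) : WithBot ℝ) ≤ y + ((-t : ℝ) : WithBot ℝ) ↔ x + (t : ℝ) ≤ y + (s : ℝ) := by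
  induction x with
  | bot => simp
  | coe x =>
    induction y with
    | bot => simp [← WithBot.coe_add]
    | coe y =>
      norm_cast
      constructor <;> intro h <;> linarith

/-- A maximum over a non-empty `I` is attained; adding crosswise avoids subtraction, so coordinates
of `x` may be `⊥`. -/
theorem mem_halfSpace_iff {a : Fin n → ℝ} {I : Finset (Fin n)} (hI : I.Nonempty)
    {x : Fin n → WithBot ℝ} :
    x ∈ halfSpace a I ↔ ∀ h ∉ I, ∃ i ∈ I, x h + (a i : WithBot ℝ) ≤ x i + (a h : WithBot ℝ) := by
  have key : x ∈ halfSpace a I ↔ ∀ h ∉ I, x h + ((-a h : ℝ) : WithBot ℝ) ≤ form a I x := by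
    simp [halfSpace, form]
  rw [key]
  refine forall₂_congr fun h _ => ?_
  obtain ⟨i₀, hi₀, hmax⟩ := I.exists_mem_eq_sup hI fun i => x i + ((-a i : ℝ) : WithBot ℝ)
  constructor
  · intro hle
    refine ⟨i₀, hi₀, ?_⟩
    rw [← withBot_add_neg_le_add_neg_iff, ← hmax]
    exact hle
  · rintro ⟨i, hi, hle⟩
    rw [← withBot_add_neg_le_add_neg_iff] at hle
    exact hle.trans (Finset.le_sup (f := fun i => x i + ((-a i : ℝ) : WithBot ℝ)) hi)

theorem toMaxPlus_mem_halfSpace_iff {a x : Fin n → ℝ} {I : Finset (Fin n)} (hI : I.Nonempty) :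
    toMaxPlus x ∈ halfSpace a I ↔ ∀ h ∉ I, ∃ i ∈ I, x h - a h ≤ x i - a i := by
  rw [mem_halfSpace_iff hI]
  refine forall₂_congr fun h _ => exists_congr fun i => and_congr_right fun _ => ?_
  simp only [toMaxPlus]
  norm_cast
  constructor <;> intro h <;> linarith

theorem halfSpace_eq_of_eq_add {a b : Fin n → ℝ} {t : ℝ} (hb : ∀ i, b i = a i + t)
    (I : Finset (Fin n)) : halfSpace b I = halfSpace a I := by
  rcases I.eq_empty_or_nonempty with rfl | hI
  · ext x
    simp [halfSpace, form]
  ext x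
  rw [mem_halfSpace_iff hI, mem_halfSpace_iff hI]
  refine forall₂_congr fun h _ => exists_congr fun i => and_congr_right fun _ => ?_
  rw [hb, hb, WithBot.coe_add, WithBot.coe_add, ← add_assoc, ← add_assoc]
  exact WithBot.add_le_add_iff_right WithBot.coe_ne_bot

/-! ### Membership in the cone -/

/-- A vector belongs to the cone if each of its coordinates is attained by a multiple of a
generator that lies below it. -/
theorem mem_cone_of_forall_exists {v : Fin p → Fin n → ℝ} {y : Fin n → WithBot ℝ}
    (hy : ∀ j, ∃ r, ∀ i, y j + (v r i : WithBot ℝ) ≤ y i + (v r j : WithBot ℝ)) :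
    y ∈ cone v := by
  choose ρ hρ using hy
  -- The coefficient of `v r` is the largest `y j - v r j` over the coordinates `j` served by `r`,
  -- and `⊥` if there are none.
  refine ⟨fun r => (Finset.univ.filter fun j => ρ j = r).sup
    fun j => y j + ((-v r j : ℝ) : WithBot ℝ), fun i => le_antisymm ?_ ?_⟩
  · refine le_trans ?_ (Finset.le_sup (Finset.mem_univ (ρ i)))
    have h1 : y i + ((-v (ρ i) i : ℝ) : WithBot ℝ) ≤ (Finset.univ.filter fun j => ρ j = ρ i).sup
        fun j => y j + ((-v (ρ i) j : ℝ) : WithBot ℝ) :=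
      Finset.le_sup (f := fun j => y j + ((-v (ρ i) j : ℝ) : WithBot ℝ)) (by simp)
    refine le_trans (le_of_eq ?_) (add_le_add_left h1 _)
    rw [add_assoc, ← WithBot.coe_add]
    simp
  · refine Finset.sup_le fun r _ => ?_
    rcases (Finset.univ.filter fun j => ρ j = r).eq_empty_or_nonempty with he | hne
    · simp [he]
    · obtain ⟨j, hj, hmax⟩ := Finset.exists_mem_eq_sup _ hne
        fun j => y j + ((-v r j : ℝ) : WithBot ℝ)
      obtain rfl : ρ j = r := by simpa using hj
      simp only [hmax]
      have h := (withBot_add_neg_le_add_neg_iff (y j) (y i) (v (ρ j) j) (v (ρ j) i)).2 (hρ j i)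
      refine (add_le_add_left h _).trans (le_of_eq ?_)
      rw [add_assoc, ← WithBot.coe_add]
      simp

theorem toMaxPlus_mem_cone {v : Fin p → Fin n → ℝ} {a : Fin n → ℝ}
    (ha : ∀ j, (typeSet v a j).Nonempty) : toMaxPlus a ∈ cone v := by
  refine mem_cone_of_forall_exists fun j => ?_
  obtain ⟨r, hr⟩ := ha j
  refine ⟨r, fun i => ?_⟩
  have := hr i
  simp only [toMaxPlus]
  norm_cast
  linarith

theorem generator_mem_cone (v : Fin p → Fin n → ℝ) (r : Fin p) : toMaxPlus (v r) ∈ cone v :=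
  mem_cone_of_forall_exists fun j => ⟨r, fun i => by simp [toMaxPlus, add_comm]⟩

theorem cone_subset_halfSpace {v : Fin p → Fin n → ℝ} {a : Fin n → ℝ} {I : Finset (Fin n)}
    (ha : ∀ r, ∃ i ∈ I, r ∈ typeSet v a i) : cone v ⊆ halfSpace a I := by
  rintro x ⟨lam, hx⟩
  change form a Iᶜ x ≤ form a I x
  unfold form
  refine Finset.sup_le fun h _ => ?_
  rcases isEmpty_or_nonempty (Fin p) with hp | hp
  · simp [hx]
  obtain ⟨r, -, hr⟩ := Finset.exists_mem_eq_sup (Finset.univ : Finset (Fin p))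
    Finset.univ_nonempty fun r => lam r + (v r h : WithBot ℝ)
  obtain ⟨i, hi, hri⟩ := ha r
  have h1 : lam r + (v r i : WithBot ℝ) ≤ x i := by
    rw [hx]
    exact Finset.le_sup (f := fun r => lam r + (v r i : WithBot ℝ)) (Finset.mem_univ r)
  refine le_trans ?_ (Finset.le_sup (f := fun i => x i + ((-a i : ℝ) : WithBot ℝ)) hi)
  refine le_trans ?_ (add_le_add_left h1 _)
  rw [hx, hr, add_assoc, add_assoc, ← WithBot.coe_add, ← WithBot.coe_add]
  refine add_le_add_right (WithBot.coe_le_coe.2 ?_) _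
  simpa [sub_eq_add_neg] using hri h

/-! ### Projecting apices into the cone -/

/-- The largest vector of the cone generated by the `v r` that lies below `a`. -/
noncomputable def coneProj [NeZero n] [NeZero p] (v : Fin p → Fin n → ℝ) (a : Fin n → ℝ)
    (i : Fin n) : ℝ :=
  Finset.univ.sup' Finset.univ_nonempty fun r =>
    (Finset.univ.inf' Finset.univ_nonempty fun k => a k - v r k) + v r i

section Projection

variable [NeZero n] [NeZero p] (v : Fin p → Fin n → ℝ) (a : Fin n → ℝ)

theorem inf_add_le_coneProj (r : Fin p) (i : Fin n) :
    (Finset.univ.inf' Finset.univ_nonempty fun k => a k - v r k) + v r i ≤ coneProj v a i :=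
  Finset.le_sup' (fun r => (Finset.univ.inf' Finset.univ_nonempty fun k => a k - v r k) + v r i)
    (Finset.mem_univ r)

theorem coneProj_le (i : Fin n) : coneProj v a i ≤ a i := by
  refine Finset.sup'_le _ _ fun r _ => ?_
  have := Finset.inf'_le (fun k => a k - v r k) (Finset.mem_univ i)
  linarith

theorem coneProj_mem_cone : toMaxPlus (coneProj v a) ∈ cone v := by
  refine toMaxPlus_mem_cone fun j => ?_
  obtain ⟨r, -, hr⟩ := Finset.exists_mem_eq_sup' (Finset.univ_nonempty (α := Fin p)) fun r =>
    (Finset.univ.inf' Finset.univ_nonempty fun k => a k - v r k) + v r j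
  refine ⟨r, fun i => ?_⟩
  have h1 := inf_add_le_coneProj v a r i
  have h2 : coneProj v a j = _ := hr
  linarith

variable {v a}

theorem coneProj_eq_of_mem_typeSet {r : Fin p} {i : Fin n} (h : r ∈ typeSet v a i) :
    coneProj v a i = a i ∧ r ∈ typeSet v (coneProj v a) i := by
  have hinf : (Finset.univ.inf' Finset.univ_nonempty fun k => a k - v r k) = a i - v r i := by
    refine le_antisymm (Finset.inf'_le _ (Finset.mem_univ i)) (Finset.le_inf' _ _ fun k _ => ?_)
    have := h k
    linarith
  have heq : coneProj v a i = a i := by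
    refine le_antisymm (coneProj_le v a i) ?_
    have := inf_add_le_coneProj v a r i
    linarith
  refine ⟨heq, fun k => ?_⟩
  have := inf_add_le_coneProj v a r k
  linarith

/-- A half-space that contains the cone can be replaced by one whose apex is the projection of
the original apex on the cone, and that excludes any given vector excluded by the original. -/
theorem exists_halfSpace_coneProj {I : Finset (Fin n)} {j : Fin n} (hj : j ∉ I)
    (hI : ∀ r, ∃ i ∈ I, r ∈ typeSet v a i) {y : Fin n → WithBot ℝ}
    (hy : ∀ i ∈ I, y i + (a j : WithBot ℝ) < y j + (a i : WithBot ℝ)) :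
    ∃ I' : Finset (Fin n), halfSpace (coneProj v a) I' ∈ supportingHalfSpaces (cone v) ∧
      y ∉ halfSpace (coneProj v a) I' := by
  classical
  -- The new sectors are those of `I` whose apex coordinate is unchanged. They still cover all
  -- generators, and lowering the `j`-th apex coordinate only helps to exclude `y`.
  have hr : ∀ r, ∃ i ∈ I.filter fun i => coneProj v a i = a i,
      r ∈ typeSet v (coneProj v a) i := fun r => by
    obtain ⟨i, hi, hri⟩ := hI r
    obtain ⟨h1, h2⟩ := coneProj_eq_of_mem_typeSet hri
    exact ⟨i, by simp [hi, h1], h2⟩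
  have hne : (I.filter fun i => coneProj v a i = a i).Nonempty := by
    obtain ⟨i, hi, -⟩ := hr 0
    exact ⟨i, hi⟩
  refine ⟨_, ⟨cone_subset_halfSpace hr, coneProj v a, coneProj_mem_cone v a, _, hne, ?_, rfl⟩, ?_⟩
  · intro h
    exact hj (Finset.mem_filter.1 (h ▸ Finset.mem_univ j)).1
  · rw [mem_halfSpace_iff hne]
    push Not
    refine ⟨j, by simp [hj], fun i hi => ?_⟩
    rw [Finset.mem_filter] at hi
    rw [hi.2]
    exact (add_le_add_right (WithBot.coe_le_coe.2 (coneProj_le v a j)) _).trans_lt (hy i hi.1)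

end Projection

/-! ### Existence of non-redundant representations -/

/-- A vector outside the cone is excluded by a half-space that contains the cone and whose apex
is built from coordinates of the generators. -/
theorem exists_separating_data [NeZero p] {v : Fin p → Fin n → ℝ} {y : Fin n → WithBot ℝ}
    (hy : y ∉ cone v) : ∃ (j : Fin n) (ρ : Fin n → Fin p) (I : Finset (Fin n)), j ∉ I ∧
      (∀ r, ∃ i ∈ I, r ∈ typeSet v (fun h => v (ρ h) h - v (ρ h) j) i) ∧
      ∀ i ∈ I, y i + ((v (ρ j) j - v (ρ j) j : ℝ) : WithBot ℝ) <
        y j + ((v (ρ i) i - v (ρ i) j : ℝ) : WithBot ℝ) := by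
  classical
  obtain ⟨j, hj⟩ : ∃ j, ∀ r, ∃ i, y i + (v r j : WithBot ℝ) < y j + (v r i : WithBot ℝ) := by
    by_contra! h
    exact hy (mem_cone_of_forall_exists h)
  let P : Fin n → Fin p → Prop := fun h r => y h + (v r j : WithBot ℝ) < y j + (v r h : WithBot ℝ)
  -- The apex coordinate at `h` is the least value `v s h - v s j` exceeding `y h - y j`, if there
  -- is one, and otherwise the greatest value of all.
  have hρ : ∀ h, ∃ r : Fin p, ((∃ s, P h s) → P h r ∧ ∀ s, P h s →
      v r h - v r j ≤ v s h - v s j) ∧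
      ((¬ ∃ s, P h s) → ∀ s, v s h - v s j ≤ v r h - v r j) := fun h => by
    by_cases hs : ∃ s, P h s
    · obtain ⟨s, hs'⟩ := hs
      obtain ⟨r, hr, hmin⟩ := (Finset.univ.filter (P h)).exists_min_image
        (fun s => v s h - v s j) ⟨s, by simpa using hs'⟩
      exact ⟨r, fun _ => ⟨by simpa using hr, fun s hs => hmin s (by simpa using hs)⟩,
        fun hn => absurd ⟨s, hs'⟩ hn⟩
    · obtain ⟨r, -, hmax⟩ := (Finset.univ : Finset (Fin p)).exists_max_image
        (fun s => v s h - v s j) Finset.univ_nonempty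
      exact ⟨r, fun hn => absurd hn hs, fun _ s => hmax s (Finset.mem_univ s)⟩
  choose ρ h1 h2 using hρ
  refine ⟨j, ρ, Finset.univ.filter fun h => ∃ s, P h s, by simp [P], ?_, ?_⟩
  · intro r
    let m : Fin n → ℝ := fun h => v r h - (v (ρ h) h - v (ρ h) j)
    obtain ⟨i₀, hi₀⟩ := hj r
    obtain ⟨i, hi, hmax⟩ := (Finset.univ.filter fun h => ∃ s, P h s).exists_max_image m
      ⟨i₀, by simpa using ⟨r, hi₀⟩⟩
    refine ⟨i, hi, fun h => ?_⟩
    change m h ≤ m i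
    -- By the choice of `ρ`, `m i₀ ≥ v r j`, whereas `m h ≤ v r j` for every `h` outside the
    -- sectors.
    by_cases hh : ∃ s, P h s
    · exact hmax h (by simpa using hh)
    · have e1 := h2 h hh r
      have e2 := (h1 i₀ ⟨r, hi₀⟩).2 r hi₀
      have e3 := hmax i₀ (by simpa using ⟨r, hi₀⟩)
      simp only [m] at e3 ⊢
      linarith
  · intro i hi
    have hP := (h1 i (by simpa using hi)).1
    simp only [P] at hP
    rw [sub_self]
    generalize v (ρ i) i = s at hP ⊢
    generalize v (ρ i) j = t at hP ⊢
    induction hyj : y j with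
    | bot => simp [hyj] at hP
    | coe c =>
      induction hyi : y i with
      | bot => simp [← WithBot.coe_add, WithBot.bot_lt_coe]
      | coe d =>
        rw [hyj, hyi] at hP
        norm_cast at hP ⊢
        linarith

theorem exists_finite_representation [NeZero n] [NeZero p] (v : Fin p → Fin n → ℝ) :
    ∃ Γ : Set (Set (Fin n → WithBot ℝ)), Γ.Finite ∧ Γ ⊆ supportingHalfSpaces (cone v) ∧
      ⋂₀ Γ = cone v := by
  let F : Fin n × (Fin n → Fin p) × Finset (Fin n) → Set (Fin n → WithBot ℝ) := fun q =>
    halfSpace (coneProj v fun h => v (q.2.1 h) h - v (q.2.1 h) q.1) q.2.2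
  refine ⟨Set.range F ∩ supportingHalfSpaces (cone v), (Set.finite_range F).inter_of_left _,
    Set.inter_subset_right, Set.Subset.antisymm ?_ ?_⟩
  · intro y hy
    by_contra hyC
    obtain ⟨j, ρ, I, hj, hI, hlt⟩ := exists_separating_data hyC
    obtain ⟨I', hsupp, hnot⟩ := exists_halfSpace_coneProj hj hI hlt
    exact hnot (hy _ ⟨⟨(j, ρ, I'), rfl⟩, hsupp⟩)
  · exact Set.subset_sInter fun H hH => hH.2.1

/-- In an inclusion-minimal representing subfamily, a half-space containing the intersection of the
others could be dropped. -/
theorem exists_nonRedundantRepresentation [NeZero n] [NeZero p] (v : Fin p → Fin n → ℝ) :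
    ∃ Γ, IsNonRedundantRepresentation (cone v) Γ := by
  obtain ⟨Γ₀, hfin, hsub, hC⟩ := exists_finite_representation v
  have hS : {Γ | Γ ⊆ Γ₀ ∧ ⋂₀ Γ = cone v}.Finite :=
    hfin.finite_subsets.subset fun Γ hΓ => hΓ.1
  obtain ⟨Γ, hΓ⟩ := hS.exists_minimal ⟨Γ₀, Set.Subset.rfl, hC⟩
  refine ⟨Γ, hfin.subset hΓ.prop.1, hΓ.prop.1.trans hsub, hΓ.prop.2, fun H hH hle => ?_⟩
  have hmem : Γ \ {H} ∈ {Γ | Γ ⊆ Γ₀ ∧ ⋂₀ Γ = cone v} := by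
    refine ⟨Set.sdiff_subset.trans hΓ.prop.1, ?_⟩
    rw [← hΓ.prop.2]
    refine Set.Subset.antisymm (fun x hx => ?_) (Set.sInter_subset_sInter Set.sdiff_subset)
    intro G hG
    by_cases hGH : G = H
    · exact hGH ▸ hle hx
    · exact hx G ⟨hG, hGH⟩
  exact (hΓ.le_of_le hmem Set.sdiff_subset hH).2 rfl

/-! ### Rigidity of the apex -/

theorem IsVertex.cone_subset {v : Fin p → Fin n → ℝ} {a : Fin n → ℝ} {I : Finset (Fin n)}
    {j : Fin n} (ha : IsVertex v a I j) : cone v ⊆ halfSpace a I := by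
  refine cone_subset_halfSpace fun r => ?_
  have hr : r ∈ ⋃ i ∈ I, typeSet v a i := ha.c1 ▸ Set.mem_univ r
  simpa using hr

theorem IsVertex.mem_cone {v : Fin p → Fin n → ℝ} {a : Fin n → ℝ} {I : Finset (Fin n)}
    {j : Fin n} (ha : IsVertex v a I j) : toMaxPlus a ∈ cone v := by
  refine toMaxPlus_mem_cone fun k => ?_
  by_cases hk : k ∈ I
  · obtain ⟨r, hr, -⟩ := Set.not_subset.1 (ha.c4 k hk)
    exact ⟨r, hr.1⟩
  · obtain ⟨i, -, r, hr⟩ := ha.c2 k hk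
    exact ⟨r, hr.2⟩

/-- A half-space that supports the cone and excludes `a + ε e_j` for arbitrarily small positive
`ε` has apex `a`. -/
theorem hasApex_of_frequently_notMem {v : Fin p → Fin n → ℝ} {a : Fin n → ℝ}
    {I : Finset (Fin n)} {j : Fin n} (ha : IsVertex v a I j) (hC5 : ConditionC5 v a I j)
    {H : Set (Fin n → WithBot ℝ)} (hH : H ∈ supportingHalfSpaces (cone v))
    (hfreq : ∃ᶠ ε : ℝ in 𝓝[>] 0, toMaxPlus (Function.update a j (a j + ε)) ∉ H) :
    HasApex H a := by
  obtain ⟨hCH, b, hb, K, hK, hK', rfl⟩ := hH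
  have haH := (toMaxPlus_mem_halfSpace_iff hK).1 (hCH ha.mem_cone)
  have hfreq' : ∃ᶠ ε : ℝ in 𝓝[>] 0, j ∉ K ∧ ∀ i ∈ K, a i - b i < a j + ε - b j := by
    refine (hfreq.and_eventually self_mem_nhdsWithin).mono ?_
    rintro ε ⟨hε, hpos⟩
    have hpos : 0 < ε := hpos
    rw [toMaxPlus_mem_halfSpace_iff hK] at hε
    push Not at hε
    obtain ⟨h, hhK, hlt⟩ := hε
    -- Only coordinate `j` was raised and `a` satisfies the inequalities, so only the one at `j` can
    -- fail.
    obtain rfl : h = j := by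
      by_contra hne
      obtain ⟨i, hi, hle⟩ := haH h hhK
      have := hlt i hi
      rw [Function.update_of_ne hne] at this
      rcases eq_or_ne i j with rfl | hij
      · rw [Function.update_self] at this
        linarith
      · rw [Function.update_of_ne hij] at this
        linarith
    refine ⟨hhK, fun i hi => ?_⟩
    have := hlt i hi
    rwa [Function.update_self, Function.update_of_ne (by rintro rfl; exact hhK hi)] at this
  have hjK : j ∉ K := hfreq'.exists.choose_spec.1
  have hleK : ∀ i ∈ K, a i - b i ≤ a j - b j := by
    intro i hi
    by_contra! hlt
    have hev : ∀ᶠ ε : ℝ in 𝓝[>] 0, ε < (a i - b i) - (a j - b j) :=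
      nhdsWithin_le_nhds (Iio_mem_nhds (by linarith))
    obtain ⟨ε, h1, h2⟩ := (hfreq'.and_eventually hev).exists
    have := h1.2 i hi
    linarith
  have hle : ∀ h, a h - b h ≤ a j - b j := by
    intro h
    by_cases hh : h ∈ K
    · exact hleK h hh
    · obtain ⟨i, hi, h1⟩ := haH h hh
      exact h1.trans (hleK i hi)
  -- (C5) gives a generator `r` with `v r - a` maximal at `i` and `j` only. As `a - b` is maximal at
  -- `j`, no sector `k ≠ i` of `K` can dominate `j` in `v r - b`, so `i` itself must.
  have hI : ∀ i ∈ I, b i - a i ≤ b j - a j := by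
    intro i hi
    obtain ⟨r, ⟨hri, hrj⟩, hr⟩ := Set.not_subset.1 (hC5 i hi)
    obtain ⟨k, hk, hle'⟩ :=
      (toMaxPlus_mem_halfSpace_iff hK).1 (hCH (generator_mem_cone v r)) j hjK
    have h1 := hri j
    have h2 := hrj i
    obtain rfl : k = i := by
      by_contra hki
      have hkj : k ≠ j := by rintro rfl; exact hjK hk
      have hrk : r ∉ typeSet v a k := fun hrk =>
        hr (Set.mem_biUnion (by simp [hki, hkj]) hrk)
      simp only [typeSet, Set.mem_ofPred_eq, not_forall, not_le] at hrk
      obtain ⟨m, hm⟩ := hrk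
      have h3 := hrj m
      have h4 := hle k
      linarith
    linarith
  have hba : ∀ i, b i = a i + (b j - a j) := by
    intro h
    have h1 := hle h
    by_cases hh : h ∈ I
    · have := hI h hh
      linarith
    -- Outside `I`, the bound comes from `b` being in the cone, hence in `H(a, I)`.
    · obtain ⟨i, hi, h2⟩ :=
        (toMaxPlus_mem_halfSpace_iff ha.nonempty).1 (ha.cone_subset hb) h hh
      have := hI i hi
      linarith
  exact ⟨K, hK, hK', halfSpace_eq_of_eq_add hba K⟩

theorem IsVertex.update_notMem_cone {v : Fin p → Fin n → ℝ} {a : Fin n → ℝ}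
    {I : Finset (Fin n)} {j : Fin n} (ha : IsVertex v a I j) {ε : ℝ} (hε : 0 < ε) :
    toMaxPlus (Function.update a j (a j + ε)) ∉ cone v := by
  intro hmem
  obtain ⟨i, hi, hle⟩ :=
    (toMaxPlus_mem_halfSpace_iff ha.nonempty).1 (ha.cone_subset hmem) j ha.notMem
  rw [Function.update_self, Function.update_of_ne (by rintro rfl; exact ha.notMem hi)] at hle
  linarith

theorem exists_hasApex_of_representation {v : Fin p → Fin n → ℝ} {a : Fin n → ℝ}
    {I : Finset (Fin n)} {j : Fin n} (ha : IsVertex v a I j) (hC5 : ConditionC5 v a I j)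
    {Γ : Set (Set (Fin n → WithBot ℝ))} (hfin : Γ.Finite)
    (hsub : Γ ⊆ supportingHalfSpaces (cone v)) (hΓ : ⋂₀ Γ = cone v) :
    ∃ H ∈ Γ, HasApex H a := by
  by_contra! hno
  -- Finiteness of `Γ` lets a single `ε` serve all its half-spaces.
  have hev : ∀ᶠ ε : ℝ in 𝓝[>] 0, ∀ H ∈ Γ, toMaxPlus (Function.update a j (a j + ε)) ∈ H := by
    refine (eventually_all_finite hfin).2 fun H hH => ?_
    by_contra hfreq
    exact hno H hH
      (hasApex_of_frequently_notMem ha hC5 (hsub hH) (not_eventually.1 hfreq))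
  obtain ⟨ε, hmem, hε⟩ := (hev.and self_mem_nhdsWithin).exists
  exact ha.update_notMem_cone hε (hΓ ▸ Set.mem_sInter.2 hmem)

end TropicalCone

theorem mainTheorem8 {n p : ℕ} (v : Fin p → Fin n → ℝ) (a : Fin n → ℝ) (I : Finset (Fin n))
    (j : Fin n) (ha : TropicalCone.IsVertex v a I j) (hC5 : TropicalCone.ConditionC5 v a I j) :
    TropicalCone.IsNonRedundantApex (TropicalCone.cone v) a := by
  have : NeZero n := ⟨by rintro rfl; exact j.elim0⟩
  have : NeZero p := by
    obtain ⟨i, -, r, -⟩ := ha.c2 j ha.notMem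
    exact ⟨by rintro rfl; exact r.elim0⟩
  exact ⟨TropicalCone.exists_nonRedundantRepresentation v, fun Γ hΓ =>
    TropicalCone.exists_hasApex_of_representation ha hC5 hΓ.1 hΓ.2.1 hΓ.2.2.1⟩
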